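/- **Model.** Call $h:\mathbb R\to\mathbb R$ an *impact function* if it is continuous, strictly increasing, $h(0)=0$, and $x\mapsto xh(x)$ is convex. Let $\gamma>0$, let $h$ be an impact function, and let $P^0=(P^0_t)_{t\ge0}$ be a càdlàg martingale on a filtered probability space $(\Omega,\mathcal F,(\mathcal F_t),\mathbb P)$ with $\mathbb P$-trivial $\mathcal F_0$ (an Almgren–Chriss model). Let $\alpha\in[0,1]$, $\kappa\ge0$, $\beta:\mathbb R\to\mathbb R$ (slippage), let $0<\tau_1<\tau_2<\dots$ be random arrival times and $\widetilde Y_1,\widetilde Y_2,\dots\in(0,\infty]$ random order sizes, and put $N_t=\max\{k:\tau_k\le t\}$. For $\widehat X\in\mathbb R$ and $\Xi\in[0,|\widehat X|]$ the fills $Y_i$ of a dark-pool order $\widehat X$ with minimum quantity $\Xi$ are defined recursively by $Y_i=\operatorname{sgn}(\widehat X)\min\bigl(\widetilde Y_i,\ |\widehat X|-\sum_{j<i}|Y_j|\bigr)$ if $\widetilde Y_i\ge\Xi$, and $Y_i=0$ otherwise; $Z_t=\sum_{i=1}^{N_t}Y_i$. Let $(\mathcal G_t)$ be the right-continuous filtration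 generated by $(\mathcal F_t)$, $Z$ and the processes $(\tau_i\wedge t)_{t\ge0}$, $i\ge1$. For $T>0$, a *round trip* on $[0,T]$ is a quadruple $\chi=(\widehat X,\Xi,\xi,\rho)$ with $\widehat X\in\mathbb R$, $\Xi\in[0,|\widehat X|]$, a $(\mathcal G_t)$-stopping time $\rho$ with $\rho<T$ a.s., and a $(\mathcal G_t)$-predictable process $\xi$ that is a.s. integrable on $[0,T]$, whose integral $\int_0^t\xi_s\,ds$, $t\le T$, is a.s. bounded uniformly in $t$ and $\omega$, and such that $\int_0^T\xi_t\,dt+Z_\rho=0$ a.s. Its costs are $$\mathcal C_T^\chi=\int_0^T\xi_tP^\chi_t\,dt+\alpha\gamma\int_0^TZ_{\rho\wedge t}\,\xi_t\,dt+\sum_{i=1}^{N_\rho}Y_i\bigl(\widehat P^\chi_{\tau_i}+\alpha\gamma Z_{\tau_i-}+\beta(Y_i)\bigr),$$ where $P^\chi_t=P^0_t+\gamma\int_0^t\xi_s\,ds+h(\xi_t)$ and $\widehat P^\chi_{t}=P^0_{t}+\gamma\int_0^{t}\xi_s\,ds+\kappa h(\xi_{t})$. There is *price manipulation* for the horizon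 $T$ if some round trip on $[0,T]$ has well-defined costs (the time integrals exist a.s. and $\mathcal C_T^\chi$ is integrable) with $\mathbb E[\mathcal C_T^\chi]<0$. **Proposition.** Suppose that $\beta=0$; that $(N_t)$ is a Poisson process with some rate $\theta>0$; that $(\widetilde Y_i)$ are i.i.d. with a law $\mu$ on $(0,\infty]$ satisfying $\mu([x,\infty])>0$ for all real $x>0$; and that the processes $(P^0_t)$, $(N_t)$ and $(\widetilde Y_i)$ are independent. Suppose moreover that $\alpha=1$ and that $$\lim_{|x|\to\infty}\frac{h(x)}{x}=0.$$ Then there is price manipulation for every horizon $T>0$. -/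

import Mathlib

open MeasureTheory ProbabilityTheory Filter Topology
open scoped NNReal ENNReal

noncomputable section

namespace DarkPool

/-- Impact functions: continuous, strictly increasing, vanishing at `0`,
and such that `x ↦ x * h x` is convex. -/
structure IsImpactFunction (h : ℝ → ℝ) : Prop where
  continuous : Continuous h
  strictMono : StrictMono h
  map_zero : h 0 = 0
  convexOn : ConvexOn ℝ Set.univ (fun x => x * h x)

/-- Right-continuous with (finite) left limits. -/
def IsCadlag (f : ℝ≥0 → ℝ) : Prop :=
  (∀ t, ContinuousWithinAt f (Set.Ici t) t) ∧
    ∀ t, ∃ l : ℝ, Tendsto f (𝓝[<] t) (𝓝 l)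

/-- `N` is a standard Poisson process with rate `θ` under `P`: it starts in `0`, has
nondecreasing right-continuous paths, independent increments, and the increments over `[s, t]`
are Poisson distributed with parameter `θ * (t - s)`. -/
structure IsPoissonProcess {Ω : Type*} [MeasurableSpace Ω] (P : Measure Ω)
    (N : ℝ≥0 → Ω → ℕ) (θ : ℝ≥0) : Prop where
  zero : ∀ᵐ ω ∂P, N 0 ω = 0
  monotone : ∀ᵐ ω ∂P, Monotone fun t => N t ω
  rightCont : ∀ᵐ ω ∂P, ∀ t, ContinuousWithinAt (fun s => N s ω) (Set.Ici t) t
  indep : HasIndepIncrements (fun t ω => (N t ω : ℝ)) P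
  law : ∀ s t, s ≤ t → P.map (fun ω => N t ω - N s ω) = poissonMeasure (θ * (t - s))

/-- An Almgren--Chriss model `(γ, h, P⁰)`. -/
structure AlmgrenChrissModel {Ω : Type*} [m : MeasurableSpace Ω] (P : Measure Ω) where
  /-- permanent-impact parameter -/
  γ : ℝ
  γ_pos : 0 < γ
  /-- temporary-impact function -/
  h : ℝ → ℝ
  isImpactFunction : IsImpactFunction h
  /-- the underlying filtration, trivial at time `0` -/
  ℱ : Filtration ℝ≥0 m
  trivial_zero : ∀ A, MeasurableSet[ℱ 0] A → P A = 0 ∨ P A = 1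
  /-- the unaffected price process -/
  price : ℝ≥0 → Ω → ℝ
  martingale : Martingale price ℱ P
  cadlag : ∀ ω, IsCadlag fun t => price t ω

/-- The parameters `(α, β, κ, (τ_i), (Ỹ_i))` of a dark-pool extension. Indices start at `0`, so
`τ i` and `Ysize i` are the arrival time and the size of the `(i + 1)`-st matching order.
Sizes may be infinite. -/
structure Extension {Ω : Type*} [MeasurableSpace Ω] (P : Measure Ω) where
  α : ℝ
  α_mem : α ∈ Set.Icc (0 : ℝ) 1
  /-- the slippage: an impact function, or no slippage at all -/
  β : ℝ → ℝ
  slippage : IsImpactFunction β ∨ β = 0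
  κ : ℝ
  κ_nonneg : 0 ≤ κ
  τ : ℕ → Ω → ℝ≥0
  measurable_τ : ∀ i, Measurable (τ i)
  τ_pos : ∀ᵐ ω ∂P, 0 < τ 0 ω
  τ_strictMono : ∀ᵐ ω ∂P, StrictMono fun i => τ i ω
  Ysize : ℕ → Ω → ℝ≥0∞
  measurable_Ysize : ∀ i, Measurable (Ysize i)
  Ysize_pos : ∀ᵐ ω ∂P, ∀ i, 0 < Ysize i ω

/-- Number of shares that are matched when an order of size `y` arrives, given that `S` shares out
of an order of size `|Xhat|` with minimum quantity `Ξ` have already been executed. -/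
def matched (Xhat Ξ S : ℝ) (y : ℝ≥0∞) : ℝ :=
  if ENNReal.ofReal Ξ ≤ y then
    (if ENNReal.ofReal S + y ≤ ENNReal.ofReal |Xhat| then y.toReal else |Xhat| - S)
  else 0

/-- Number of shares executed against the first `n` incoming orders `y 0, …, y (n - 1)`. -/
def executed (Xhat Ξ : ℝ) (y : ℕ → ℝ≥0∞) : ℕ → ℝ
  | 0 => 0
  | n + 1 => executed Xhat Ξ y n + matched Xhat Ξ (executed Xhat Ξ y n) (y n)

namespace Extension

variable {Ω : Type*} [m : MeasurableSpace Ω] {P : Measure Ω} (D : Extension P)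

/-- `N t`: the number of arrivals up to (and including) time `t`; for a strictly increasing
sequence of arrival times this is the largest `k` for which the `k`-th arrival is at or
before `t`. -/
def N (t : ℝ≥0) (ω : Ω) : ℕ := Set.ncard {i | D.τ i ω ≤ t}

/-- The signed fill `Y_i` generated by the `i`-th incoming order. -/
def Y (Xhat Ξ : ℝ) (i : ℕ) (ω : Ω) : ℝ :=
  Real.sign Xhat *
    matched Xhat Ξ (executed Xhat Ξ (fun j => D.Ysize j ω) i) (D.Ysize i ω)

/-- `Z t`: the number of shares executed in the dark pool up to time `t`. -/
def Z (Xhat Ξ : ℝ) (t : ℝ≥0) (ω : Ω) : ℝ :=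
  ∑ i ∈ Finset.range (D.N t ω), D.Y Xhat Ξ i ω

theorem measurable_N (t : ℝ≥0) : Measurable (D.N t) := by
  have hS : ∀ F : Finset ℕ, MeasurableSet {ω | {i | D.τ i ω ≤ t} = (F : Set ℕ)} := by
    intro F
    have : {ω | {i | D.τ i ω ≤ t} = (F : Set ℕ)} = ⋂ i, {ω | D.τ i ω ≤ t ↔ i ∈ F} := by
      ext ω
      simp [Set.ext_iff]
    rw [this]
    refine MeasurableSet.iInter fun i => ?_
    have h1 : MeasurableSet {ω | D.τ i ω ≤ t} := D.measurable_τ i measurableSet_Iic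
    by_cases hi : i ∈ F
    · simpa [hi] using h1
    · simp only [hi, iff_false]
      exact h1.compl
  have hfin : ∀ p : Finset ℕ → Prop,
      MeasurableSet (⋃ F : Finset ℕ, ⋃ _ : p F, {ω | {i | D.τ i ω ≤ t} = (F : Set ℕ)}) :=
    fun p => MeasurableSet.iUnion fun F => MeasurableSet.iUnion fun _ => hS F
  refine measurable_to_countable' fun n => ?_
  have key : D.N t ⁻¹' {n} =
      (⋃ F : Finset ℕ, ⋃ _ : F.card = n, {ω | {i | D.τ i ω ≤ t} = (F : Set ℕ)}) ∪
      ((⋃ F : Finset ℕ, ⋃ _ : True, {ω | {i | D.τ i ω ≤ t} = (F : Set ℕ)})ᶜ ∩ {_ω | n = 0}) := by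
    ext ω
    simp only [Set.mem_preimage, Set.mem_singleton_iff, Set.mem_union, Set.mem_iUnion,
      Set.mem_ofPred_eq, exists_prop, Set.mem_inter_iff, Set.mem_compl_iff, true_and, N]
    by_cases h : {i | D.τ i ω ≤ t}.Finite
    · obtain ⟨F, hF⟩ := h.exists_finset_coe
      rw [← hF, Set.ncard_coe_finset]
      constructor
      · intro hn
        exact Or.inl ⟨F, hn, rfl⟩
      · rintro (⟨G, hG, hGF⟩ | ⟨hne, -⟩)
        · rw [Finset.coe_injective hGF, hG]
        · exact absurd ⟨F, rfl⟩ hne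
    · rw [Set.Infinite.ncard h]
      constructor
      · intro hn
        refine Or.inr ⟨?_, hn.symm⟩
        rintro ⟨G, hG⟩
        exact h (hG ▸ G.finite_toSet)
      · rintro (⟨G, -, hGF⟩ | ⟨-, hn⟩)
        · exact absurd (hGF ▸ G.finite_toSet) h
        · exact hn.symm
  rw [key]
  exact (hfin _).union ((hfin _).compl.inter (MeasurableSet.const _))

theorem _root_.DarkPool.measurable_matched (Xhat Ξ : ℝ) :
    Measurable fun p : ℝ × ℝ≥0∞ => matched Xhat Ξ p.1 p.2 := by
  unfold matched
  refine Measurable.ite (measurableSet_le measurable_const measurable_snd) ?_ measurable_const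
  refine Measurable.ite (measurableSet_le ?_ measurable_const) ?_ ?_
  · exact (ENNReal.measurable_ofReal.comp measurable_fst).add measurable_snd
  · exact measurable_snd.ennreal_toReal
  · exact measurable_const.sub measurable_fst

theorem measurable_executed (Xhat Ξ : ℝ) (n : ℕ) :
    Measurable fun ω => executed Xhat Ξ (fun j => D.Ysize j ω) n := by
  induction n with
  | zero => exact measurable_const
  | succ n ih =>
    exact ih.add ((measurable_matched Xhat Ξ).comp (ih.prodMk (D.measurable_Ysize n)))

theorem measurable_Y (Xhat Ξ : ℝ) (i : ℕ) : Measurable (D.Y Xhat Ξ i) :=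
  measurable_const.mul ((measurable_matched Xhat Ξ).comp
    ((D.measurable_executed Xhat Ξ i).prodMk (D.measurable_Ysize i)))

theorem measurable_Z (Xhat Ξ : ℝ) (t : ℝ≥0) : Measurable (D.Z Xhat Ξ t) := by
  have h : Measurable fun p : ℕ × Ω => ∑ i ∈ Finset.range p.1, D.Y Xhat Ξ i p.2 :=
    measurable_from_prod_countable_right fun n =>
      Finset.measurable_sum (Finset.range n) fun i _ => D.measurable_Y Xhat Ξ i
  exact h.comp ((D.measurable_N t).prodMk measurable_id)

/-- The right-continuous filtration `(𝒢_t)` generated by `(ℱ_t)`, `Z`, and the processes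
`(τ_i ∧ t)`. -/
def 𝒢 (ℱ : Filtration ℝ≥0 m) (Xhat Ξ : ℝ) : Filtration ℝ≥0 m :=
  (ℱ ⊔ Filtration.natural (D.Z Xhat Ξ) (fun t => (D.measurable_Z Xhat Ξ t).stronglyMeasurable) ⊔
    ⨆ i, Filtration.natural (fun t ω => min (D.τ i ω) t)
      (fun _ => ((D.measurable_τ i).min measurable_const).stronglyMeasurable)).rightCont

end Extension

/-- A quadruple `χ = (X̂, Ξ, ξ, ρ)`: dark-pool order, minimum quantity level, trading speed at the
exchange, cancellation time of the dark-pool order. -/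
structure Strategy (Ω : Type*) where
  Xhat : ℝ
  Ξ : ℝ
  ξ : ℝ≥0 → Ω → ℝ
  ρ : Ω → ℝ≥0

namespace Strategy

variable {Ω : Type*} [m : MeasurableSpace Ω] {P : Measure Ω}

/-- `∫_0^t ξ_s ds`. -/
def cum (χ : Strategy Ω) (t : ℝ≥0) (ω : Ω) : ℝ :=
  ∫ s in (0 : ℝ)..t, χ.ξ s.toNNReal ω

/-- The set `𝒳(X₀, T)` of admissible strategies, as a predicate. -/
structure IsAdmissible (M : AlmgrenChrissModel P) (D : Extension P) (X₀ : ℝ) (T : ℝ≥0)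
    (χ : Strategy Ω) : Prop where
  Ξ_mem : χ.Ξ ∈ Set.Icc 0 |χ.Xhat|
  isStoppingTime : IsStoppingTime (D.𝒢 M.ℱ χ.Xhat χ.Ξ) fun ω => (χ.ρ ω : WithTop ℝ≥0)
  ρ_lt : ∀ᵐ ω ∂P, χ.ρ ω < T
  predictable : IsStronglyPredictable (D.𝒢 M.ℱ χ.Xhat χ.Ξ) χ.ξ
  integrable : ∀ᵐ ω ∂P, IntervalIntegrable (fun s : ℝ => χ.ξ s.toNNReal ω) volume 0 T
  bounded : ∃ C : ℝ, ∀ᵐ ω ∂P, ∀ t ≤ T, |χ.cum t ω| ≤ C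
  liquidation : ∀ᵐ ω ∂P, X₀ + χ.cum T ω + D.Z χ.Xhat χ.Ξ (χ.ρ ω) ω = 0

/-- The price `P^χ_t` at the exchange. -/
def exchangePrice (M : AlmgrenChrissModel P) (χ : Strategy Ω) (t : ℝ≥0) (ω : Ω) : ℝ :=
  M.price t ω + M.γ * χ.cum t ω + M.h (χ.ξ t ω)

/-- The price at which a dark-pool fill at time `t` is executed. -/
def darkPrice (M : AlmgrenChrissModel P) (D : Extension P) (χ : Strategy Ω)
    (t : ℝ≥0) (ω : Ω) : ℝ :=
  M.price t ω + M.γ * χ.cum t ω + D.κ * M.h (χ.ξ t ω)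

/-- The costs `𝒞_T^χ`. -/
def cost (M : AlmgrenChrissModel P) (D : Extension P) (X₀ : ℝ) (T : ℝ≥0)
    (χ : Strategy Ω) (ω : Ω) : ℝ :=
  X₀ * M.price 0 ω
  + (∫ t in (0 : ℝ)..T, χ.ξ t.toNNReal ω * χ.exchangePrice M t.toNNReal ω)
  + D.α * M.γ *
      (∫ t in (0 : ℝ)..T, D.Z χ.Xhat χ.Ξ (min (χ.ρ ω) t.toNNReal) ω * χ.ξ t.toNNReal ω)
  + ∑ i ∈ Finset.range (D.N (χ.ρ ω) ω),
      D.Y χ.Xhat χ.Ξ i ω *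
        (χ.darkPrice M D (D.τ i ω) ω
          + D.α * M.γ * Function.leftLim (fun t => D.Z χ.Xhat χ.Ξ t ω) (D.τ i ω)
          + D.β (D.Y χ.Xhat χ.Ξ i ω))

/-- A price manipulation strategy: a round trip (`X₀ = 0`) with strictly negative expected costs.
The integrals that enter the costs and the expectation are required to exist, so that no default
value of an undefined integral is ever used. -/
structure IsPriceManipulation (M : AlmgrenChrissModel P) (D : Extension P) (T : ℝ≥0)
    (χ : Strategy Ω) : Prop where
  admissible : χ.IsAdmissible M D 0 T
  integrable_exchange : ∀ᵐ ω ∂P, IntervalIntegrable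
    (fun t : ℝ => χ.ξ t.toNNReal ω * χ.exchangePrice M t.toNNReal ω) volume 0 T
  integrable_dark : ∀ᵐ ω ∂P, IntervalIntegrable
    (fun t : ℝ => D.Z χ.Xhat χ.Ξ (min (χ.ρ ω) t.toNNReal) ω * χ.ξ t.toNNReal ω) volume 0 T
  integrable_cost : Integrable (χ.cost M D 0 T) P
  cost_neg : ∫ ω, χ.cost M D 0 T ω ∂P < 0

end Strategy

/-- There is price manipulation for the horizon `T`. -/
def HasPriceManipulation {Ω : Type*} [MeasurableSpace Ω] {P : Measure Ω}
    (M : AlmgrenChrissModel P) (D : Extension P) (T : ℝ≥0) : Prop :=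
  ∃ χ : Strategy Ω, χ.IsPriceManipulation M D T

/-- Zero slippage; Poisson arrivals; i.i.d. order sizes on `(0, ∞]` that are unbounded from above;
independence of the price process, the arrival process, and the sequence of order sizes. -/
structure IndependenceAssumption {Ω : Type*} [MeasurableSpace Ω] {P : Measure Ω}
    (M : AlmgrenChrissModel P) (D : Extension P) : Prop where
  slippage_zero : D.β = 0
  poisson : ∃ θ : ℝ≥0, 0 < θ ∧ IsPoissonProcess P D.N θ
  sizes_indep : iIndepFun D.Ysize P
  sizes_law : ∃ μ : Measure ℝ≥0∞, μ {0} = 0 ∧ (∀ x : ℝ≥0, 0 < x → 0 < μ (Set.Ici (x : ℝ≥0∞))) ∧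
    ∀ i, P.map (D.Ysize i) = μ
  indep : iIndep
    ![⨆ t, MeasurableSpace.comap (M.price t) inferInstance,
      ⨆ t, MeasurableSpace.comap (D.N t) inferInstance,
      ⨆ i, MeasurableSpace.comap (D.Ysize i) inferInstance] P

end DarkPool

end

/-! The manipulation is to buy in the dark pool and sell at the exchange. Put `r = T / 2` and place
a buy order of size `X > 0` with minimum quantity `X`, trading nothing at the exchange up to time
`r`; then cancel, and sell whatever was filled at constant speed on `(r, 2r]`. The full minimum
quantity makes the position `Z_r` either `0` or `X`, acquired in a single fill.

The fill itself pays no impact: the exchange speed is still zero, and nothing was filled before.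
Since `α = 1`, it raises the exchange price by `γX`, and the sale pushes this back linearly to zero.
Shares are thus sold at an average premium `γX / 2`, a gain of `γX² / 2`; the temporary impact of
the sale costs `-X * h (-X / r)`, which is `o(X²)` for sublinear `h`. So for large `X` the impact
part of the costs is a negative constant on the event of a fill and zero elsewhere.

The unaffected price contributes nothing on average. Fill size and fill time depend only on arrivals
and order sizes, so they are independent of the martingale; buying at the fill time and selling over
`(r, 2r]` both have expected unit price `E[P⁰_0]`, by Fubini (`integral_mul_eval_of_indepFun`,
`integral_mul_time_of_indepFun`). The pathwise costs are computed in `liquidation_cost`, a fill has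
positive probability by `measure_Z_ne_zero_pos`, and `exists_pos_gain_of_sublinear` chooses `X`. -/

noncomputable section

namespace DarkPool

/-! ### Joint measurability, and Fubini for processes at independent times. -/

/-- A process with right-continuous paths is jointly measurable. -/
theorem measurable_uncurry_of_rightCont {α : Type*} [MeasurableSpace α] {f : ℝ≥0 → α → ℝ}
    (hf : ∀ t, Measurable (f t))
    (hc : ∀ a t, ContinuousWithinAt (fun s => f s a) (Set.Ici t) t) :
    Measurable fun p : ℝ≥0 × α => f p.1 p.2 := by
  -- Times are approximated from the right by the next point of the grid of mesh `1 / (n + 1)`. The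
  -- approximant takes countably many values, so only measurability at fixed times is needed.
  have hge : ∀ (t : ℝ≥0) (n : ℕ),
      t ≤ ((⌊((n : ℝ≥0) + 1) * t⌋₊ : ℝ≥0) + 1) / ((n : ℝ≥0) + 1) := fun t n =>
    (le_div_iff₀ (by positivity)).2 (by rw [mul_comm]; exact (Nat.lt_floor_add_one _).le)
  have hlim : ∀ t : ℝ≥0, Tendsto
      (fun n : ℕ => ((⌊((n : ℝ≥0) + 1) * t⌋₊ : ℝ≥0) + 1) / ((n : ℝ≥0) + 1)) atTop (𝓝[≥] t) := by
    intro t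
    refine tendsto_nhdsWithin_iff.2 ⟨?_, Eventually.of_forall fun n => ?_⟩
    · have h0 : Tendsto (fun n : ℕ => (1 : ℝ≥0) / ((n : ℝ≥0) + 1)) atTop (𝓝 0) :=
        NNReal.tendsto_coe.1 (by simpa using tendsto_one_div_add_atTop_nhds_zero_nat (𝕜 := ℝ))
      refine tendsto_of_tendsto_of_tendsto_of_le_of_le (g := fun _ => t)
        (h := fun n : ℕ => t + 1 / ((n : ℝ≥0) + 1)) tendsto_const_nhds
        (by simpa using tendsto_const_nhds.add h0) (hge t) (fun n => ?_)
      · have : ((⌊((n : ℝ≥0) + 1) * t⌋₊ : ℝ≥0) + 1) ≤ ((n : ℝ≥0) + 1) * t + 1 := by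
          gcongr
          exact Nat.floor_le (by positivity)
        refine ((div_le_div_iff_of_pos_right (by positivity)).2 this).trans (le_of_eq ?_)
        field_simp
    · exact hge t n
  refine measurable_of_tendsto_metrizable (f := fun (n : ℕ) (p : ℝ≥0 × α) =>
    f (((⌊((n : ℝ≥0) + 1) * p.1⌋₊ : ℝ≥0) + 1) / ((n : ℝ≥0) + 1)) p.2) (fun n => ?_)
    (tendsto_pi_nhds.2 fun p => (hc p.2 p.1).tendsto.comp (hlim p.1))
  have h1 : Measurable fun q : ℕ × α => f (((q.1 : ℝ≥0) + 1) / ((n : ℝ≥0) + 1)) q.2 := by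
    refine measurable_from_prod_countable_right fun k => ?_
    exact hf (((k : ℝ≥0) + 1) / ((n : ℝ≥0) + 1))
  have h2 : Measurable fun p : ℝ≥0 × α => (⌊((n : ℝ≥0) + 1) * p.1⌋₊, p.2) := by
    refine Measurable.prodMk ?_ measurable_snd
    exact Nat.measurable_floor.comp (measurable_fst.const_mul _)
  simpa only [Function.comp_def] using h1.comp h2

section Independence

variable {Ω α : Type*} [MeasurableSpace Ω] [MeasurableSpace α] {P : Measure Ω}
  [IsProbabilityMeasure P] {f : ℝ≥0 → α → ℝ} {U : Ω → α} {T : ℝ≥0} {C c : ℝ}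

/-- Evaluating a process with constant expectation at an independent bounded random time, with an
independent bounded weight. -/
theorem integral_mul_eval_of_indepFun (hf : Measurable fun p : ℝ≥0 × α => f p.1 p.2)
    (hU : Measurable U) {v : Ω → ℝ≥0} {ψ : Ω → ℝ} (hv : Measurable v) (hψ : Measurable ψ)
    (hind : IndepFun U (fun ω => (v ω, ψ ω)) P) (hvT : ∀ ω, v ω ≤ T) {K : ℝ}
    (hψK : ∀ ω, |ψ ω| ≤ K) (hint : ∀ t ≤ T, Integrable (fun ω => f t (U ω)) P)
    (hC : ∀ t ≤ T, ∫ ω, |f t (U ω)| ∂P ≤ C) (hc : ∀ t ≤ T, ∫ ω, f t (U ω) ∂P = c) :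
    Integrable (fun ω => ψ ω * f (v ω) (U ω)) P ∧
      ∫ ω, ψ ω * f (v ω) (U ω) ∂P = (∫ ω, ψ ω ∂P) * c := by
  have hV : Measurable fun ω => (v ω, ψ ω) := hv.prodMk hψ
  have hUV : Measurable fun ω => (U ω, (v ω, ψ ω)) := hU.prodMk hV
  have hΦ : Measurable fun p : α × (ℝ≥0 × ℝ) => p.2.2 * f p.2.1 p.1 :=
    measurable_snd.snd.mul (hf.comp (measurable_snd.fst.prodMk measurable_fst))
  have hmap := hind.map_prod_eq_prod_map_map hU.aemeasurable hV.aemeasurable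
  have : IsProbabilityMeasure (P.map U) := Measure.isProbabilityMeasure_map hU.aemeasurable
  have : IsProbabilityMeasure (P.map fun ω => (v ω, ψ ω)) :=
    Measure.isProbabilityMeasure_map hV.aemeasurable
  have hft : ∀ t, Measurable (f t) := fun t => hf.comp measurable_prodMk_left
  have hsupp : ∀ᵐ q ∂(P.map fun ω => (v ω, ψ ω)), q.1 ≤ T ∧ |q.2| ≤ K := by
    rw [ae_map_iff hV.aemeasurable]
    · exact Eventually.of_forall fun ω => ⟨hvT ω, hψK ω⟩
    · exact (measurableSet_le measurable_fst measurable_const).inter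
        (measurableSet_le measurable_snd.abs measurable_const)
  -- By independence the joint law is a product; freezing time and weight, the inner `L¹` norm is at
  -- most `K * C`.
  have hI : Integrable (fun p : α × (ℝ≥0 × ℝ) => p.2.2 * f p.2.1 p.1)
      ((P.map U).prod (P.map fun ω => (v ω, ψ ω))) := by
    rw [integrable_prod_iff' hΦ.aestronglyMeasurable]
    constructor
    · filter_upwards [hsupp] with q hq
      exact ((integrable_map_measure (hft q.1).aestronglyMeasurable hU.aemeasurable).2
        (hint q.1 hq.1)).const_mul q.2
    · refine Integrable.of_bound (C := K * C)
        (hΦ.norm.stronglyMeasurable.integral_prod_left').aestronglyMeasurable ?_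
      filter_upwards [hsupp] with q hq
      have hnn : 0 ≤ ∫ x, |f q.1 x| ∂(P.map U) := integral_nonneg fun _ => abs_nonneg _
      have hle : ∫ x, |f q.1 x| ∂(P.map U) ≤ C := by
        rw [integral_map hU.aemeasurable (hft q.1).abs.aestronglyMeasurable]
        exact hC q.1 hq.1
      simp only [Real.norm_eq_abs, abs_mul, integral_const_mul, abs_abs, abs_of_nonneg hnn]
      exact mul_le_mul hq.2 hle hnn ((abs_nonneg _).trans hq.2)
  have hI' := hI
  rw [← hmap, integrable_map_measure hΦ.aestronglyMeasurable hUV.aemeasurable] at hI'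
  refine ⟨hI', ?_⟩
  calc ∫ ω, ψ ω * f (v ω) (U ω) ∂P
      = ∫ p, p.2.2 * f p.2.1 p.1 ∂(P.map fun ω => (U ω, (v ω, ψ ω))) :=
        (integral_map hUV.aemeasurable hΦ.aestronglyMeasurable).symm
    _ = ∫ q, ∫ x, q.2 * f q.1 x ∂(P.map U) ∂(P.map fun ω => (v ω, ψ ω)) := by
        rw [hmap, integral_prod_symm _ hI]
    _ = ∫ q, q.2 * c ∂(P.map fun ω => (v ω, ψ ω)) := by
        refine integral_congr_ae ?_
        filter_upwards [hsupp] with q hq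
        rw [integral_const_mul, integral_map hU.aemeasurable (hft q.1).aestronglyMeasurable,
          hc q.1 hq.1]
    _ = (∫ ω, ψ ω ∂P) * c := by
        rw [integral_mul_const, integral_map hV.aemeasurable measurable_snd.aestronglyMeasurable]

/-- Tonelli with an `L¹` bound uniform over a bounded time interval. It serves both the exchange of
integrals and the almost sure existence of the pathwise time integral. -/
theorem integrable_prod_time (hf : Measurable fun p : ℝ≥0 × α => f p.1 p.2) (hU : Measurable U)
    {r : ℝ≥0} (hint : ∀ t ≤ T, Integrable (fun ω => f t (U ω)) P)
    (hC : ∀ t ≤ T, ∫ ω, |f t (U ω)| ∂P ≤ C) :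
    Integrable (fun p : Ω × ℝ => f p.2.toNNReal (U p.1))
      (P.prod (volume.restrict (Set.Ioc (r : ℝ) T))) := by
  have hm : Measurable fun p : Ω × ℝ => f p.2.toNNReal (U p.1) :=
    hf.comp (measurable_snd.real_toNNReal.prodMk (hU.comp measurable_fst))
  have hT : ∀ᵐ t ∂(volume.restrict (Set.Ioc (r : ℝ) T)), t.toNNReal ≤ T := by
    filter_upwards [ae_restrict_mem measurableSet_Ioc] with t ht
    exact Real.toNNReal_le_iff_le_coe.2 ht.2
  rw [integrable_prod_iff' hm.aestronglyMeasurable]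
  constructor
  · filter_upwards [hT] with t ht using hint _ ht
  · refine Integrable.of_bound (C := C)
      (hm.norm.stronglyMeasurable.integral_prod_left').aestronglyMeasurable ?_
    filter_upwards [hT] with t ht
    simp only [Real.norm_eq_abs]
    rw [abs_of_nonneg (integral_nonneg fun _ => abs_nonneg _)]
    exact hC _ ht

theorem ae_intervalIntegrable_time (hf : Measurable fun p : ℝ≥0 × α => f p.1 p.2)
    (hU : Measurable U) {r : ℝ≥0} (hr : r ≤ T)
    (hint : ∀ t ≤ T, Integrable (fun ω => f t (U ω)) P)
    (hC : ∀ t ≤ T, ∫ ω, |f t (U ω)| ∂P ≤ C) :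
    ∀ᵐ ω ∂P, IntervalIntegrable (fun t : ℝ => f t.toNNReal (U ω)) volume r T := by
  filter_upwards [(integrable_prod_time hf hU (r := r) hint hC).prod_right_ae] with ω hω
  rwa [intervalIntegrable_iff_integrableOn_Ioc_of_le (by exact_mod_cast hr)]

/-- The time integral of a process with constant expectation, with an independent weight. -/
theorem integral_mul_time_of_indepFun (hf : Measurable fun p : ℝ≥0 × α => f p.1 p.2)
    (hU : Measurable U) {r : ℝ≥0} (hr : r ≤ T) {ψ : Ω → ℝ} (hψ : Integrable ψ P)
    (hind : IndepFun U ψ P) (hint : ∀ t ≤ T, Integrable (fun ω => f t (U ω)) P)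
    (hC : ∀ t ≤ T, ∫ ω, |f t (U ω)| ∂P ≤ C) (hc : ∀ t ≤ T, ∫ ω, f t (U ω) ∂P = c) :
    Integrable (fun ω => ψ ω * ∫ t in (r : ℝ)..T, f t.toNNReal (U ω)) P ∧
      ∫ ω, ψ ω * (∫ t in (r : ℝ)..T, f t.toNNReal (U ω)) ∂P
        = (∫ ω, ψ ω ∂P) * (((T : ℝ) - r) * c) := by
  have hrT : (r : ℝ) ≤ T := by exact_mod_cast hr
  have hI := integrable_prod_time hf hU (r := r) hint hC
  have hm : Measurable fun p : α × ℝ => f p.2.toNNReal p.1 :=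
    hf.comp (measurable_snd.real_toNNReal.prodMk measurable_fst)
  have hA : Measurable fun x : α => ∫ t in (r : ℝ)..T, f t.toNNReal x := by
    simp only [intervalIntegral.integral_of_le hrT]
    exact hm.stronglyMeasurable.integral_prod_right'.measurable
  have hAI : Integrable (fun ω => ∫ t in (r : ℝ)..T, f t.toNNReal (U ω)) P := by
    simp only [intervalIntegral.integral_of_le hrT]
    exact hI.integral_prod_left
  have hψA : IndepFun ψ (fun ω => ∫ t in (r : ℝ)..T, f t.toNNReal (U ω)) P :=
    hind.symm.comp measurable_id hA
  refine ⟨hψA.integrable_mul hψ hAI, ?_⟩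
  rw [hψA.integral_fun_mul_eq_mul_integral hψ.1 hAI.1]
  congr 1
  simp only [intervalIntegral.integral_of_le hrT]
  rw [integral_integral_swap hI]
  have : ∫ t in Set.Ioc (r : ℝ) T, ∫ ω, f t.toNNReal (U ω) ∂P = ∫ t in Set.Ioc (r : ℝ) T, c := by
    refine setIntegral_congr_fun measurableSet_Ioc fun t ht => ?_
    exact hc _ (Real.toNNReal_le_iff_le_coe.2 ht.2)
  rw [this]
  simp [hrT]

end Independence

/-! ### Integrals of functions that vanish up to time `r`. -/

section Step

variable {r t : ℝ} {g : ℝ → ℝ}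

theorem intervalIntegrable_ite_lt (hr : 0 ≤ r) (ht : r ≤ t)
    (hg : IntervalIntegrable g volume r t) :
    IntervalIntegrable (fun s => if r < s then g s else 0) volume 0 t := by
  rw [intervalIntegrable_iff_integrableOn_Ioc_of_le ht] at hg
  have : (fun s => if r < s then g s else 0) = (Set.Ioi r).indicator g := by
    ext s; simp [Set.indicator_apply]
  rw [this]
  rw [intervalIntegrable_iff_integrableOn_Ioc_of_le (hr.trans ht), IntegrableOn,
    integrable_indicator_iff measurableSet_Ioi, IntegrableOn,
    Measure.restrict_restrict measurableSet_Ioi]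
  exact hg.mono_set fun s hs => ⟨hs.1, hs.2.2⟩

theorem integral_ite_lt (hr : 0 ≤ r) (ht : r ≤ t) :
    ∫ s in (0 : ℝ)..t, (if r < s then g s else 0) = ∫ s in r..t, g s := by
  have : (fun s => if r < s then g s else 0) = (Set.Ioi r).indicator g := by
    ext s; simp [Set.indicator_apply]
  rw [this, intervalIntegral.integral_of_le (hr.trans ht), intervalIntegral.integral_of_le ht,
    setIntegral_indicator measurableSet_Ioi]
  congr 2
  ext s
  simp only [Set.mem_inter_iff, Set.mem_Ioc, Set.mem_Ioi]
  constructor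
  · rintro ⟨⟨-, h⟩, h'⟩; exact ⟨h', h⟩
  · rintro ⟨h, h'⟩; exact ⟨⟨hr.trans_lt h, h'⟩, h⟩

end Step

end DarkPool
end

/-! ### Fills of a buy order, in particular with full minimum quantity. -/

noncomputable section

namespace DarkPool

variable {X : ℝ}

/-- With full minimum quantity the order is filled at once by the first large enough order. -/
theorem executed_self (hX : 0 < X) (y : ℕ → ℝ≥0∞) (n : ℕ) :
    executed X X y n = if ∃ i < n, ENNReal.ofReal X ≤ y i then X else 0 := by
  induction n with
  | zero => simp [executed]
  | succ n ih =>
    have hiff : (∃ i < n + 1, ENNReal.ofReal X ≤ y i) ↔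
        (∃ i < n, ENNReal.ofReal X ≤ y i) ∨ ENNReal.ofReal X ≤ y n := by
      simp only [Nat.lt_succ_iff_lt_or_eq]
      constructor
      · rintro ⟨i, h | rfl, hi⟩
        exacts [Or.inl ⟨i, h, hi⟩, Or.inr hi]
      · rintro (⟨i, h, hi⟩ | hi)
        exacts [⟨i, Or.inl h, hi⟩, ⟨n, Or.inr rfl, hi⟩]
    rw [executed, ih, matched, abs_of_pos hX, if_congr hiff rfl rfl]
    by_cases hy : ENNReal.ofReal X ≤ y n
    · by_cases hp : ∃ i < n, ENNReal.ofReal X ≤ y i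
      -- The order is already complete, so the match is the remainder `X - X = 0`.
      · have hlt : ¬ ENNReal.ofReal X + y n ≤ ENNReal.ofReal X := by
          intro hle
          have h1 : ENNReal.ofReal X + ENNReal.ofReal X ≤ ENNReal.ofReal X :=
            (add_le_add_right hy _).trans hle
          rw [← ENNReal.ofReal_add hX.le hX.le, ENNReal.ofReal_le_ofReal_iff hX.le] at h1
          linarith
        simp [hy, hp, hlt]
      · by_cases hle : y n ≤ ENNReal.ofReal X
        · simp [hp, le_antisymm hle hy, hX.le]
        · simp [hy, hp, hle]
    · simp [hy]

/-- The measurable space is left arbitrary so that the `σ`-algebra `orderFlow` can be put on `Ω`. -/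
theorem measurable_executed_comp {α : Type*} [MeasurableSpace α] (Xhat Ξ : ℝ) {n : α → ℕ}
    {y : ℕ → α → ℝ≥0∞} (hn : Measurable n) (hy : ∀ i, Measurable (y i)) :
    Measurable fun a => executed Xhat Ξ (fun j => y j a) (n a) := by
  have h : ∀ k, Measurable fun a => executed Xhat Ξ (fun j => y j a) k := by
    intro k
    induction k with
    | zero => exact measurable_const
    | succ k ih => exact ih.add ((measurable_matched Xhat Ξ).comp (ih.prodMk (hy k)))
  exact (measurable_from_prod_countable_right
    (f := fun p : ℕ × α => executed Xhat Ξ (fun j => y j p.2) p.1) h).comp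
    (hn.prodMk measurable_id)

variable {Ω : Type*} [m : MeasurableSpace Ω] {P : Measure Ω} (D : Extension P)

theorem Extension.Y_eq_sub (hX : 0 < X) (Ξ : ℝ) (i : ℕ) (ω : Ω) :
    D.Y X Ξ i ω = executed X Ξ (fun j => D.Ysize j ω) (i + 1)
      - executed X Ξ (fun j => D.Ysize j ω) i := by
  rw [Extension.Y, executed, Real.sign_of_pos hX]
  ring

theorem Extension.Z_eq_executed (hX : 0 < X) (Ξ : ℝ) (t : ℝ≥0) (ω : Ω) :
    D.Z X Ξ t ω = executed X Ξ (fun j => D.Ysize j ω) (D.N t ω) := by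
  simp only [Extension.Z, D.Y_eq_sub hX]
  rw [Finset.sum_range_sub]
  simp [executed]

theorem Extension.Z_self (hX : 0 < X) (t : ℝ≥0) (ω : Ω) :
    D.Z X X t ω = if ∃ i < D.N t ω, ENNReal.ofReal X ≤ D.Ysize i ω then X else 0 := by
  rw [D.Z_eq_executed hX, executed_self hX]

/-- The execution time of an order, capped at `r`, as a functional of the paths of `Z`. -/
def Extension.fillTime (D : Extension P) (X Ξ : ℝ) (r : ℝ≥0) (ω : Ω) : ℝ≥0 :=
  ⨅ q : ℚ, if D.Z X Ξ (q : ℝ).toNNReal ω ≠ 0 then min (q : ℝ).toNNReal r else r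

theorem Extension.fillTime_le (X Ξ : ℝ) (r : ℝ≥0) (ω : Ω) : D.fillTime X Ξ r ω ≤ r := by
  refine (ciInf_le (OrderBot.bddBelow _) (0 : ℚ)).trans ?_
  split_ifs
  exacts [min_le_right _ _, le_rfl]

theorem Extension.N_le_of_lt {ω : Ω} (hτ : StrictMono fun i => D.τ i ω) {t : ℝ≥0} {J : ℕ}
    (h : t < D.τ J ω) : D.N t ω ≤ J := by
  have hsub : {i | D.τ i ω ≤ t} ⊆ (Finset.range J : Set ℕ) := by
    intro i hi
    simpa using hτ.lt_iff_lt.1 (lt_of_le_of_lt hi h)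
  simpa [Extension.N] using Set.ncard_le_ncard hsub (Finset.finite_toSet _)

theorem Extension.le_of_lt_N {ω : Ω} (hτ : StrictMono fun i => D.τ i ω) {t : ℝ≥0} {J : ℕ}
    (h : J < D.N t ω) : D.τ J ω ≤ t := by
  by_contra! hlt
  exact absurd (D.N_le_of_lt hτ hlt) (not_le.2 h)

/-- `Set.ncard` is `0` on infinite sets, so a positive count at `r` rules out infinitely many
arrivals up to `r`; only then does the count at `t ≤ r` dominate. -/
theorem Extension.lt_N_of_le {ω : Ω} (hτ : StrictMono fun i => D.τ i ω) {t r : ℝ≥0} {J : ℕ}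
    (hJ : D.τ J ω ≤ t) (htr : t ≤ r) (h : 0 < D.N r ω) : J < D.N t ω := by
  have hfin : {i | D.τ i ω ≤ t}.Finite :=
    (Set.finite_of_ncard_pos h).subset fun i hi => le_trans hi htr
  have hsub : (Finset.range (J + 1) : Set ℕ) ⊆ {i | D.τ i ω ≤ t} := by
    intro i hi
    exact (hτ.monotone (Nat.lt_succ_iff.1 (by simpa using hi))).trans hJ
  have := Set.ncard_le_ncard hsub hfin
  rw [Set.ncard_coe_finset, Finset.card_range] at this
  exact this

theorem Extension.Z_self_eq_zero {ω : Ω} (hX : 0 < X) {J n : ℕ} {t : ℝ≥0}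
    (hmin : ∀ i < J, ¬ ENNReal.ofReal X ≤ D.Ysize i ω) (hn : D.N t ω = n) (hnJ : n ≤ J) :
    D.Z X X t ω = 0 := by
  rw [D.Z_self hX, if_neg]
  rintro ⟨i, hi, h⟩
  exact hmin i (by omega) h

/-- `Z` vanishes before the first sufficiently large order and is nonzero from its arrival up to
`r`, so rational times close above that arrival detect it. -/
theorem Extension.fillTime_self (hX : 0 < X) {ω : Ω} (hτ : StrictMono fun i => D.τ i ω)
    {r : ℝ≥0} {J : ℕ} (hJ : J < D.N r ω) (hJX : ENNReal.ofReal X ≤ D.Ysize J ω)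
    (hmin : ∀ i < J, ¬ ENNReal.ofReal X ≤ D.Ysize i ω) : D.fillTime X X r ω = D.τ J ω := by
  have hJr := D.le_of_lt_N hτ hJ
  have hpos : 0 < D.N r ω := by omega
  refine le_antisymm ?_ (le_ciInf fun q => ?_)
  · rcases hJr.eq_or_lt with h | h
    · rw [h]; exact D.fillTime_le X X r ω
    · refine le_of_forall_gt fun b hb => ?_
      -- The rational must stay below `r`, where finiteness of the arrivals is known.
      obtain ⟨q, hq1, hq2⟩ := exists_rat_btwn (NNReal.coe_lt_coe.2 (lt_min hb h))
      have hq1' : D.τ J ω < (q : ℝ).toNNReal := Real.lt_toNNReal_iff_coe_lt.2 hq1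
      have hq2' : (q : ℝ).toNNReal < min b r :=
        (Real.toNNReal_lt_iff_lt_coe (le_trans (NNReal.coe_nonneg _) hq1.le)).2 hq2
      have hZ : D.Z X X (q : ℝ).toNNReal ω ≠ 0 := by
        rw [D.Z_self hX, if_pos ⟨J, D.lt_N_of_le hτ hq1'.le (hq2'.le.trans (min_le_right _ _)) hpos,
          hJX⟩]
        exact hX.ne'
      refine (ciInf_le (OrderBot.bddBelow _) q).trans_lt ?_
      rw [if_pos hZ]
      exact (min_le_left _ _).trans_lt (hq2'.trans_le (min_le_left _ _))
  · split_ifs with hq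
    · refine le_min ?_ hJr
      by_contra! hlt
      exact hq (D.Z_self_eq_zero hX hmin rfl (D.N_le_of_lt hτ hlt))
    · exact hJr

/-- This removes the dark-pool impact from the price of the fill: there is no earlier fill to cause
it. -/
theorem Extension.leftLim_Z_self (hX : 0 < X) {ω : Ω} (hτ : StrictMono fun i => D.τ i ω)
    (h0 : 0 < D.τ 0 ω) {J : ℕ} (hmin : ∀ i < J, ¬ ENNReal.ofReal X ≤ D.Ysize i ω) :
    Function.leftLim (fun t => D.Z X X t ω) (D.τ J ω) = 0 := by
  have hpos : 0 < D.τ J ω := h0.trans_le (hτ.monotone (Nat.zero_le J))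
  have := nhdsLT_neBot_of_exists_lt ⟨0, hpos⟩
  refine leftLim_eq_of_tendsto ?_
  refine tendsto_const_nhds.congr' ?_
  filter_upwards [self_mem_nhdsWithin] with t ht
  exact (D.Z_self_eq_zero hX hmin rfl (D.N_le_of_lt hτ ht)).symm

/-- Sums over the fills of an order with full minimum quantity. -/
theorem Extension.sum_Y_self_mul (hX : 0 < X) {ω : Ω} (hτ : StrictMono fun i => D.τ i ω)
    (h0 : 0 < D.τ 0 ω) {r : ℝ≥0} (p : ℝ≥0 → ℝ) (a : ℝ) :
    ∑ i ∈ Finset.range (D.N r ω), D.Y X X i ω *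
        (p (D.τ i ω) + a * Function.leftLim (fun t => D.Z X X t ω) (D.τ i ω))
      = D.Z X X r ω * p (D.fillTime X X r ω) := by
  classical
  by_cases hE : ∃ i < D.N r ω, ENNReal.ofReal X ≤ D.Ysize i ω
  · have hE' : ∃ i, i < D.N r ω ∧ ENNReal.ofReal X ≤ D.Ysize i ω := hE
    have hJ := (Nat.find_spec hE').1
    have hJX := (Nat.find_spec hE').2
    have hmin : ∀ i < Nat.find hE', ¬ ENNReal.ofReal X ≤ D.Ysize i ω := fun i hi h =>
      Nat.find_min hE' hi ⟨hi.trans hJ, h⟩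
    rw [Finset.sum_eq_single (Nat.find hE')]
    · rw [D.leftLim_Z_self hX hτ h0 hmin, D.fillTime_self hX hτ hJ hJX hmin, D.Z_self hX,
        if_pos hE, D.Y_eq_sub hX, executed_self hX, executed_self hX,
        if_pos ⟨_, Nat.lt_succ_self _, hJX⟩, if_neg]
      · ring
      · rintro ⟨i, hi, h⟩
        exact hmin i hi h
    · intro i _ hne
      rw [D.Y_eq_sub hX, executed_self hX, executed_self hX]
      rcases lt_or_gt_of_ne hne with h | h
      · rw [if_neg, if_neg]
        · ring
        · rintro ⟨j, hj, h'⟩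
          exact hmin j (hj.trans h) h'
        · rintro ⟨j, hj, h'⟩
          exact hmin j (by omega) h'
      · rw [if_pos ⟨_, h.trans (Nat.lt_succ_self _), hJX⟩, if_pos ⟨_, h, hJX⟩]
        ring
    · intro h
      exact absurd (Finset.mem_range.2 hJ) h
  · rw [D.Z_self hX, if_neg hE, zero_mul]
    refine Finset.sum_eq_zero fun i hi => ?_
    have hi' := Finset.mem_range.1 hi
    rw [D.Y_eq_sub hX, executed_self hX, executed_self hX, if_neg, if_neg]
    · ring
    · rintro ⟨j, hj, h⟩
      exact hE ⟨j, by omega, h⟩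
    · rintro ⟨j, hj, h⟩
      exact hE ⟨j, by omega, h⟩

/-! ### The round trip: pathwise costs and admissibility. -/

section Liquidation

/-- Wait in the dark pool with a full minimum quantity until time `r`; then sell the fill at a
constant rate over a period of length `r`. -/
def liquidation (D : Extension P) (X : ℝ) (r : ℝ≥0) : Strategy Ω where
  Xhat := X
  Ξ := X
  ξ t ω := if r < t then -D.Z X X r ω / r else 0
  ρ _ := r

variable {r : ℝ≥0} {ω : Ω}

theorem liquidation_ξ_toNNReal (s : ℝ) :
    (liquidation D X r).ξ s.toNNReal ω = if (r : ℝ) < s then -D.Z X X r ω / r else 0 := by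
  simp only [liquidation, Real.lt_toNNReal_iff_coe_lt]

theorem liquidation_cum_of_le {t : ℝ≥0} (ht : t ≤ r) : (liquidation D X r).cum t ω = 0 := by
  simp only [Strategy.cum, liquidation_ξ_toNNReal]
  rw [intervalIntegral.integral_congr (g := fun _ => (0 : ℝ))]
  · simp
  · intro s hs
    rw [Set.uIcc_of_le t.coe_nonneg] at hs
    exact if_neg (not_lt.2 (hs.2.trans (by exact_mod_cast ht)))

theorem liquidation_cum_of_ge {t : ℝ≥0} (ht : r ≤ t) :
    (liquidation D X r).cum t ω = (t - r) * (-D.Z X X r ω / r) := by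
  simp only [Strategy.cum, liquidation_ξ_toNNReal]
  rw [integral_ite_lt r.coe_nonneg (by exact_mod_cast ht)]
  rw [intervalIntegral.integral_const, smul_eq_mul]

theorem liquidation_abs_cum_le (hX : 0 < X) (hr : 0 < r) {t : ℝ≥0} (ht : t ≤ r + r) :
    |(liquidation D X r).cum t ω| ≤ X := by
  rcases le_total t r with h | h
  · rw [liquidation_cum_of_le D h]; simpa using hX.le
  · have h1 : (r : ℝ) ≤ t := by exact_mod_cast h
    have h2 : (t : ℝ) ≤ r + r := by exact_mod_cast ht
    have hr' : (0 : ℝ) < r := hr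
    have hZ : |D.Z X X r ω| ≤ X := by
      rw [D.Z_self hX]
      split_ifs
      · rw [abs_of_pos hX]
      · simpa using hX.le
    rw [liquidation_cum_of_ge D h, abs_mul, abs_div, abs_neg, abs_of_pos hr',
      abs_of_nonneg (sub_nonneg.2 h1), mul_div_assoc', div_le_iff₀ hr', mul_comm X]
    exact mul_le_mul (by linarith) hZ (abs_nonneg _) hr'.le

variable (M : AlmgrenChrissModel P)

theorem liquidation_ξ_mul_exchangePrice (s : ℝ) :
    (liquidation D X r).ξ s.toNNReal ω * (liquidation D X r).exchangePrice M s.toNNReal ω =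
      if (r : ℝ) < s then (-D.Z X X r ω / r) * (M.price s.toNNReal ω +
        (M.γ * ((s - r) * (-D.Z X X r ω / r)) + M.h (-D.Z X X r ω / r))) else 0 := by
  rw [liquidation_ξ_toNNReal]
  split_ifs with h
  · have hrs : r < s.toNNReal := Real.lt_toNNReal_iff_coe_lt.2 h
    rw [Strategy.exchangePrice, liquidation_cum_of_ge D hrs.le, liquidation_ξ_toNNReal, if_pos h,
      Real.coe_toNNReal s ((NNReal.coe_nonneg r).trans h.le)]
    ring
  · rw [zero_mul]

theorem liquidation_Z_mul_ξ (s : ℝ) :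
    D.Z X X (min r s.toNNReal) ω * (liquidation D X r).ξ s.toNNReal ω =
      if (r : ℝ) < s then D.Z X X r ω * (-D.Z X X r ω / r) else 0 := by
  rw [liquidation_ξ_toNNReal]
  split_ifs with h
  · rw [min_eq_left (Real.lt_toNNReal_iff_coe_lt.2 h).le]
  · rw [mul_zero]

theorem liquidation_intervalIntegrable_ξ :
    IntervalIntegrable (fun s : ℝ => (liquidation D X r).ξ s.toNNReal ω) volume 0
      ((r + r : ℝ≥0) : ℝ) := by
  simp only [liquidation_ξ_toNNReal]
  exact intervalIntegrable_ite_lt r.coe_nonneg (by simp) intervalIntegrable_const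

theorem liquidation_intervalIntegrable_dark :
    IntervalIntegrable (fun s : ℝ => D.Z X X (min r s.toNNReal) ω *
      (liquidation D X r).ξ s.toNNReal ω) volume 0 ((r + r : ℝ≥0) : ℝ) := by
  simp only [liquidation_Z_mul_ξ]
  exact intervalIntegrable_ite_lt r.coe_nonneg (by simp) intervalIntegrable_const

theorem liquidation_intervalIntegrable_exchange
    (hp : IntervalIntegrable (fun s : ℝ => M.price s.toNNReal ω) volume r ((r + r : ℝ≥0) : ℝ)) :
    IntervalIntegrable (fun s : ℝ => (liquidation D X r).ξ s.toNNReal ω *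
      (liquidation D X r).exchangePrice M s.toNNReal ω) volume 0 ((r + r : ℝ≥0) : ℝ) := by
  simp only [liquidation_ξ_mul_exchangePrice]
  refine intervalIntegrable_ite_lt r.coe_nonneg (by simp) (IntervalIntegrable.const_mul (hp.add ?_) _)
  exact Continuous.intervalIntegrable (by fun_prop) _ _

/-- With `Z = Z_r`, the permanent impact of the sale costs `γZ² / 2`, while selling at a price
raised by `γZ` contributes `-γZ²`; the balance is `-γZ² / 2`. -/
theorem liquidation_cost (hX : 0 < X) (hr : 0 < r) (hα : D.α = 1) (hβ : D.β = 0)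
    (hτ : StrictMono fun i => D.τ i ω) (h0 : 0 < D.τ 0 ω)
    (hp : IntervalIntegrable (fun s : ℝ => M.price s.toNNReal ω) volume r ((r + r : ℝ≥0) : ℝ)) :
    (liquidation D X r).cost M D 0 (r + r) ω =
      D.Z X X r ω * M.price (D.fillTime X X r ω) ω
      - (r : ℝ)⁻¹ * (D.Z X X r ω * ∫ s in (r : ℝ)..((r + r : ℝ≥0) : ℝ), M.price s.toNNReal ω)
      + (-(M.γ / 2 * D.Z X X r ω ^ 2) - D.Z X X r ω * M.h (-D.Z X X r ω / r)) := by
  have hr' : (0 : ℝ) < r := hr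
  have hle : (r : ℝ) ≤ ((r + r : ℝ≥0) : ℝ) := by simp
  have hsum : ∑ i ∈ Finset.range (D.N r ω), D.Y X X i ω *
        ((liquidation D X r).darkPrice M D (D.τ i ω) ω
          + D.α * M.γ * Function.leftLim (fun t => D.Z X X t ω) (D.τ i ω)
          + D.β (D.Y X X i ω)) = D.Z X X r ω * M.price (D.fillTime X X r ω) ω := by
    rw [← D.sum_Y_self_mul hX hτ h0 (fun t => M.price t ω) (D.α * M.γ)]
    refine Finset.sum_congr rfl fun i hi => ?_
    have hi' := D.le_of_lt_N hτ (Finset.mem_range.1 hi)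
    -- No exchange trading happens up to `r`, so `κ` multiplies `h 0 = 0`.
    have hξ : (liquidation D X r).ξ (D.τ i ω) ω = 0 := if_neg (not_lt.2 hi')
    rw [Strategy.darkPrice, liquidation_cum_of_le D hi', hξ, M.isImpactFunction.map_zero, hβ]
    simp
  have hex : ∫ s in (0 : ℝ)..((r + r : ℝ≥0) : ℝ), (liquidation D X r).ξ s.toNNReal ω *
      (liquidation D X r).exchangePrice M s.toNNReal ω = (-D.Z X X r ω / r) *
        ((∫ s in (r : ℝ)..((r + r : ℝ≥0) : ℝ), M.price s.toNNReal ω) +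
        (M.γ * (r ^ 2 / 2 * (-D.Z X X r ω / r)) + r * M.h (-D.Z X X r ω / r))) := by
    simp only [liquidation_ξ_mul_exchangePrice]
    rw [integral_ite_lt r.coe_nonneg hle, intervalIntegral.integral_const_mul,
      intervalIntegral.integral_add hp (Continuous.intervalIntegrable (by fun_prop) _ _),
      intervalIntegral.integral_add (Continuous.intervalIntegrable (by fun_prop) _ _)
        intervalIntegrable_const, intervalIntegral.integral_const_mul,
      intervalIntegral.integral_mul_const,
      intervalIntegral.integral_sub intervalIntegral.intervalIntegrable_id intervalIntegrable_const,
      integral_id, intervalIntegral.integral_const, intervalIntegral.integral_const]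
    simp only [NNReal.coe_add, smul_eq_mul]
    ring
  have hdk : ∫ s in (0 : ℝ)..((r + r : ℝ≥0) : ℝ), D.Z X X (min r s.toNNReal) ω *
      (liquidation D X r).ξ s.toNNReal ω = r * (D.Z X X r ω * (-D.Z X X r ω / r)) := by
    simp only [liquidation_Z_mul_ξ]
    rw [integral_ite_lt r.coe_nonneg hle, intervalIntegral.integral_const]
    simp
  have hcost : (liquidation D X r).cost M D 0 (r + r) ω =
      0 * M.price 0 ω
      + (∫ s in (0 : ℝ)..((r + r : ℝ≥0) : ℝ), (liquidation D X r).ξ s.toNNReal ω *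
          (liquidation D X r).exchangePrice M s.toNNReal ω)
      + D.α * M.γ * (∫ s in (0 : ℝ)..((r + r : ℝ≥0) : ℝ), D.Z X X (min r s.toNNReal) ω *
          (liquidation D X r).ξ s.toNNReal ω)
      + ∑ i ∈ Finset.range (D.N r ω), D.Y X X i ω *
        ((liquidation D X r).darkPrice M D (D.τ i ω) ω
          + D.α * M.γ * Function.leftLim (fun t => D.Z X X t ω) (D.τ i ω)
          + D.β (D.Y X X i ω)) := rfl
  rw [hcost, hsum, hex, hdk, hα]
  field_simp
  ring

theorem liquidation_isAdmissible (hX : 0 < X) (hr : 0 < r) :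
    (liquidation D X r).IsAdmissible M D 0 (r + r) where
  Ξ_mem := ⟨hX.le, le_abs_self X⟩
  isStoppingTime := isStoppingTime_const _ _
  ρ_lt := Eventually.of_forall fun _ => lt_add_of_pos_left r hr
  predictable := by
    set 𝒢 := D.𝒢 M.ℱ X X
    have hle : Filtration.natural (D.Z X X)
        (fun t => (D.measurable_Z X X t).stronglyMeasurable) ≤ 𝒢 :=
      le_trans (le_sup_right.trans le_sup_left) (Filtration.le_rightCont _)
    have hZ : Measurable[𝒢 r] (D.Z X X r) :=
      (Filtration.stronglyAdapted_natural
        (fun t => (D.measurable_Z X X t).stronglyMeasurable) r).measurable.mono (hle r) le_rfl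
    have hE : MeasurableSet[𝒢.predictable] (Set.Ioi r ×ˢ (D.Z X X r ⁻¹' {X})) :=
      measurableSet_predictable_Ioi_prod (hZ (measurableSet_singleton X))
    -- As `Z_r` is `0` or `X`, the speed is a constant times the indicator of one predictable
    -- rectangle.
    have heq : Function.uncurry (liquidation D X r).ξ =
        (Set.Ioi r ×ˢ (D.Z X X r ⁻¹' {X})).indicator fun _ => -X / (r : ℝ) := by
      ext ⟨t, ω⟩
      have hv : D.Z X X r ω = X ∨ D.Z X X r ω = 0 := by
        rw [D.Z_self hX]; split_ifs <;> simp
      rcases hv with h | h <;>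
        simp [Function.uncurry, liquidation, Set.indicator, h, hX.ne]
    rw [IsStronglyPredictable, heq]
    exact stronglyMeasurable_const.indicator hE
  integrable := Eventually.of_forall fun _ => liquidation_intervalIntegrable_ξ D
  bounded := ⟨X, Eventually.of_forall fun _ _ ht => liquidation_abs_cum_le D hX hr ht⟩
  liquidation := Eventually.of_forall fun ω => by
    have hr' : (r : ℝ) ≠ 0 := by exact_mod_cast hr.ne'
    rw [liquidation_cum_of_ge D (le_add_of_nonneg_left zero_le)]
    simp only [DarkPool.liquidation, NNReal.coe_add]
    field_simp
    ring

end Liquidation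

end DarkPool
end

/-! ### Independence of price and order flow, and the expected costs. -/

noncomputable section

namespace DarkPool

/-- Conditional expectation contracts `L¹`. The value at the horizon thus gives the uniform bound
required for Fubini. -/
theorem _root_.MeasureTheory.Martingale.integral_abs_le {Ω ι : Type*} [Preorder ι]
    {m : MeasurableSpace Ω} {P : Measure Ω} [IsFiniteMeasure P] {ℱ : Filtration ι m}
    {f : ι → Ω → ℝ} (hf : Martingale f ℱ P) {s t : ι} (hst : s ≤ t) :
    ∫ ω, |f s ω| ∂P ≤ ∫ ω, |f t ω| ∂P := by
  calc ∫ ω, |f s ω| ∂P = ∫ ω, |(P[f t|ℱ s]) ω| ∂P :=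
        integral_congr_ae ((hf.2 s t hst).symm.fun_comp abs)
    _ ≤ ∫ ω, |f t ω| ∂P := integral_abs_condExp_le _

variable {Ω : Type*} [m : MeasurableSpace Ω] {P : Measure Ω} {X : ℝ}

/-- The unaffected price as a random path. -/
def AlmgrenChrissModel.path (M : AlmgrenChrissModel P) (ω : Ω) : {f : ℝ≥0 → ℝ // IsCadlag f} :=
  ⟨fun t => M.price t ω, M.cadlag ω⟩

theorem AlmgrenChrissModel.measurable_price (M : AlmgrenChrissModel P) (t : ℝ≥0) :
    Measurable (M.price t) :=
  ((M.martingale.1 t).mono (M.ℱ.le t)).measurable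

theorem measurable_cadlag_mk {α : Type*} [MeasurableSpace α] {f : ℝ≥0 → α → ℝ}
    (hf : ∀ t, Measurable (f t)) (hc : ∀ a, IsCadlag fun t => f t a) :
    Measurable fun a => (⟨fun t => f t a, hc a⟩ : {f : ℝ≥0 → ℝ // IsCadlag f}) :=
  Measurable.subtype_mk (measurable_pi_iff.2 hf)

theorem AlmgrenChrissModel.comap_path_le (M : AlmgrenChrissModel P) :
    MeasurableSpace.comap M.path inferInstance
      ≤ ⨆ t, MeasurableSpace.comap (M.price t) inferInstance := by
  rw [← measurable_iff_comap_le]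
  refine @measurable_cadlag_mk Ω (⨆ t, MeasurableSpace.comap (M.price t) inferInstance) M.price
    (fun t => ?_) M.cadlag
  exact (comap_measurable (M.price t)).mono
    (le_iSup (fun t => MeasurableSpace.comap (M.price t) inferInstance) t) le_rfl

theorem AlmgrenChrissModel.measurable_path (M : AlmgrenChrissModel P) : Measurable M.path :=
  measurable_cadlag_mk M.measurable_price M.cadlag

/-- Evaluation at a variable time is jointly measurable here because paths are right-continuous;
this is why the path space is the subtype of càdlàg functions. -/
theorem measurable_cadlag_eval :
    Measurable fun p : ℝ≥0 × {f : ℝ≥0 → ℝ // IsCadlag f} => p.2.1 p.1 :=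
  measurable_uncurry_of_rightCont (f := fun t (g : {f : ℝ≥0 → ℝ // IsCadlag f}) => g.1 t)
    (fun t => (measurable_pi_apply t).comp measurable_subtype_coe) fun g t => g.2.1 t

section Fill

variable (D : Extension P)

/-- The `σ`-algebra generated by the arrivals and the order sizes. -/
abbrev Extension.orderFlow : MeasurableSpace Ω :=
  (⨆ t, MeasurableSpace.comap (D.N t) inferInstance) ⊔
    ⨆ i, MeasurableSpace.comap (D.Ysize i) inferInstance

theorem Extension.measurable_orderFlow_Z (hX : 0 < X) (Ξ : ℝ) (t : ℝ≥0) :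
    Measurable[D.orderFlow] (D.Z X Ξ t) := by
  have hN : Measurable[D.orderFlow] (D.N t) := (comap_measurable (D.N t)).mono
    ((le_iSup (fun t => MeasurableSpace.comap (D.N t) inferInstance) t).trans le_sup_left) le_rfl
  have hY : ∀ i, Measurable[D.orderFlow] (D.Ysize i) := fun i =>
    (comap_measurable (D.Ysize i)).mono
      ((le_iSup (fun i => MeasurableSpace.comap (D.Ysize i) inferInstance) i).trans le_sup_right)
      le_rfl
  have heq : D.Z X Ξ t = fun ω => executed X Ξ (fun j => D.Ysize j ω) (D.N t ω) :=
    funext fun ω => D.Z_eq_executed hX Ξ t ω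
  rw [heq]
  exact @measurable_executed_comp Ω D.orderFlow X Ξ _ _ hN hY

theorem measurable_iInf_rat_ite {α : Type*} [MeasurableSpace α] {Z : ℝ≥0 → α → ℝ}
    (hZ : ∀ t, Measurable (Z t)) (r : ℝ≥0) :
    Measurable fun a =>
      ⨅ q : ℚ, if Z (q : ℝ).toNNReal a ≠ 0 then min (q : ℝ).toNNReal r else r :=
  Measurable.iInf fun _ => Measurable.ite (hZ _ (measurableSet_singleton 0)).compl
    measurable_const measurable_const

theorem Extension.measurable_orderFlow_fillTime (hX : 0 < X) (Ξ : ℝ) (r : ℝ≥0) :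
    Measurable[D.orderFlow] (D.fillTime X Ξ r) :=
  @measurable_iInf_rat_ite Ω D.orderFlow _ (D.measurable_orderFlow_Z hX Ξ) r

theorem Extension.orderFlow_le : D.orderFlow ≤ m :=
  sup_le (iSup_le fun t => (D.measurable_N t).comap_le)
    (iSup_le fun i => (D.measurable_Ysize i).comap_le)

variable {D} {M : AlmgrenChrissModel P}

theorem IndependenceAssumption.indep_price_orderFlow (h : IndependenceAssumption M D) :
    Indep (⨆ t, MeasurableSpace.comap (M.price t) inferInstance) D.orderFlow P := by
  have h1 := indep_iSup_of_disjoint (S := {0}) (T := {1, 2}) ?_ h.indep (by simp)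
  · simpa [iSup_insert, iSup_singleton, Extension.orderFlow] using h1
  · intro i
    fin_cases i
    · exact iSup_le fun t => (M.measurable_price t).comap_le
    · exact iSup_le fun t => (D.measurable_N t).comap_le
    · exact iSup_le fun i => (D.measurable_Ysize i).comap_le

theorem IndependenceAssumption.indepFun_path (h : IndependenceAssumption M D) {β : Type*}
    [MeasurableSpace β] {V : Ω → β} (hV : Measurable[D.orderFlow] V) :
    IndepFun M.path V P := by
  rw [IndepFun_iff_Indep]
  exact indep_of_indep_of_le h.indep_price_orderFlow M.comap_path_le hV.comap_le

/-- It suffices that some order arrives by time `r` and that the first size is at least `X`. These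
are independent events of positive probability. -/
theorem IndependenceAssumption.measure_Z_ne_zero_pos [IsProbabilityMeasure P]
    (h : IndependenceAssumption M D) (hX : 0 < X) {r : ℝ≥0} (hr : 0 < r) :
    0 < P {ω | D.Z X X r ω ≠ 0} := by
  have hind : Indep (⨆ t, MeasurableSpace.comap (D.N t) inferInstance)
      (⨆ i, MeasurableSpace.comap (D.Ysize i) inferInstance) P :=
    h.indep.indep (i := 1) (j := 2) (by decide)
  have hA : MeasurableSet[⨆ t, MeasurableSpace.comap (D.N t) inferInstance] {ω | 0 < D.N r ω} :=
    le_iSup (fun t => MeasurableSpace.comap (D.N t) inferInstance) r _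
      ⟨Set.Ioi 0, measurableSet_Ioi, rfl⟩
  have hB : MeasurableSet[⨆ i, MeasurableSpace.comap (D.Ysize i) inferInstance]
      {ω | ENNReal.ofReal X ≤ D.Ysize 0 ω} :=
    le_iSup (fun i => MeasurableSpace.comap (D.Ysize i) inferInstance) 0 _
      ⟨Set.Ici (ENNReal.ofReal X), measurableSet_Ici, rfl⟩
  have hPA : 0 < P {ω | 0 < D.N r ω} := by
    obtain ⟨θ, hθ, hN⟩ := h.poisson
    have h1 := hN.law 0 r zero_le
    -- A Poisson variable with positive parameter equals `1` with positive probability.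
    have h2 : 0 < (P.map (fun ω => D.N r ω - D.N 0 ω)) {1} := by
      rw [h1, poissonMeasure_singleton]
      have : (0 : ℝ) < (θ * (r - 0) : ℝ≥0) := by
        rw [tsub_zero]; exact_mod_cast mul_pos hθ hr
      exact ENNReal.ofReal_pos.2 (by positivity)
    have hsub : Measurable fun ω => D.N r ω - D.N 0 ω :=
      (D.measurable_N r).sub (D.measurable_N 0)
    rw [Measure.map_apply hsub (measurableSet_singleton 1)] at h2
    refine h2.trans_le (measure_mono fun ω hω => ?_)
    have hω' : D.N r ω - D.N 0 ω = 1 := hω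
    change 0 < D.N r ω
    omega
  have hPB : 0 < P {ω | ENNReal.ofReal X ≤ D.Ysize 0 ω} := by
    obtain ⟨μ, -, hμ, hlaw⟩ := h.sizes_law
    have h1 := hμ X.toNNReal (Real.toNNReal_pos.2 hX)
    rw [← hlaw 0, Measure.map_apply (D.measurable_Ysize 0) measurableSet_Ici] at h1
    exact h1
  have hAB := (Indep_iff _ _ P).1 hind _ _ hA hB
  refine (ENNReal.mul_pos hPA.ne' hPB.ne').trans_le (hAB.symm.le.trans (measure_mono ?_))
  rintro ω ⟨hω, hω'⟩
  change D.Z X X r ω ≠ 0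
  rw [D.Z_self hX, if_pos ⟨0, hω, hω'⟩]
  exact hX.ne'

variable [IsProbabilityMeasure P]

theorem liquidation_isPriceManipulation (h : IndependenceAssumption M D) (hα : D.α = 1)
    (hX : 0 < X) {r : ℝ≥0} (hr : 0 < r)
    (hneg : -(M.γ / 2 * X ^ 2) - X * M.h (-X / r) < 0) :
    (liquidation D X r).IsPriceManipulation M D (r + r) := by
  have hm := measurable_cadlag_eval
  have hU := M.measurable_path
  have hint : ∀ t ≤ r + r, Integrable (fun ω => (M.path ω).1 t) P := fun t _ =>
    M.martingale.integrable t
  have hC : ∀ t ≤ r + r, ∫ ω, |(M.path ω).1 t| ∂P ≤ ∫ ω, |M.price (r + r) ω| ∂P := fun t ht =>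
    M.martingale.integral_abs_le ht
  have hc : ∀ t ≤ r + r, ∫ ω, (M.path ω).1 t ∂P = ∫ ω, M.price 0 ω ∂P := fun t _ => by
    have := M.martingale.setIntegral_eq (zero_le (a := t)) MeasurableSet.univ
    rw [setIntegral_univ, setIntegral_univ] at this
    exact this.symm
  have hZm := D.measurable_Z X X r
  have hZK : ∀ ω, |D.Z X X r ω| ≤ X := fun ω => by
    rw [D.Z_self hX]
    split_ifs
    · rw [abs_of_pos hX]
    · simpa using hX.le
  have hZI : Integrable (D.Z X X r) P :=
    Integrable.of_bound hZm.aestronglyMeasurable X (Eventually.of_forall hZK)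
  have hZf := D.measurable_orderFlow_Z hX X r
  have hσf := D.measurable_orderFlow_fillTime hX X r
  have hσm : Measurable (D.fillTime X X r) := hσf.mono D.orderFlow_le le_rfl
  have hfill := integral_mul_eval_of_indepFun (f := fun t (g : {f : ℝ≥0 → ℝ // IsCadlag f}) => g.1 t) hm hU hσm hZm
    (h.indepFun_path (hσf.prodMk hZf))
    (fun ω => (D.fillTime_le X X r ω).trans (le_add_of_nonneg_left zero_le)) hZK hint hC hc
  have hsell := integral_mul_time_of_indepFun (f := fun t (g : {f : ℝ≥0 → ℝ // IsCadlag f}) => g.1 t) (r := r) hm hU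
    (le_add_of_nonneg_left zero_le) hZI (h.indepFun_path hZf) hint hC hc
  have hslice := ae_intervalIntegrable_time (f := fun t (g : {f : ℝ≥0 → ℝ // IsCadlag f}) => g.1 t) (r := r) hm hU
    (le_add_of_nonneg_left zero_le) hint hC
  have hτ0 : ∀ᵐ ω ∂P, (StrictMono fun i => D.τ i ω) ∧ 0 < D.τ 0 ω :=
    D.τ_strictMono.and D.τ_pos
  set c := -(M.γ / 2 * X ^ 2) - X * M.h (-X / r) with hcdef
  have hE : MeasurableSet {ω | D.Z X X r ω ≠ 0} := (hZm (measurableSet_singleton 0)).compl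
  -- Since `Z_r` takes only the values `0` and `X`, negativity is needed at the single size `X`, not
  -- at smaller partial fills.
  have hrest : ∀ ω, -(M.γ / 2 * D.Z X X r ω ^ 2) - D.Z X X r ω * M.h (-D.Z X X r ω / r) =
      {ω | D.Z X X r ω ≠ 0}.indicator (fun _ => c) ω := by
    intro ω
    have hv : D.Z X X r ω = X ∨ D.Z X X r ω = 0 := by
      rw [D.Z_self hX]; split_ifs <;> simp
    rcases hv with h | h <;> simp [h, hX.ne', hcdef]
  have hcost : (liquidation D X r).cost M D 0 (r + r) =ᵐ[P] fun ω =>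
      D.Z X X r ω * M.price (D.fillTime X X r ω) ω
      - (r : ℝ)⁻¹ * (D.Z X X r ω * ∫ s in (r : ℝ)..((r + r : ℝ≥0) : ℝ), M.price s.toNNReal ω)
      + {ω | D.Z X X r ω ≠ 0}.indicator (fun _ => c) ω := by
    filter_upwards [hτ0, hslice] with ω h1 h2
    rw [← hrest]
    exact liquidation_cost D M hX hr hα h.slippage_zero h1.1 h1.2 h2
  have hI1 : Integrable (fun ω => D.Z X X r ω * M.price (D.fillTime X X r ω) ω) P := hfill.1
  have hI2 : Integrable (fun ω => (r : ℝ)⁻¹ *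
      (D.Z X X r ω * ∫ s in (r : ℝ)..((r + r : ℝ≥0) : ℝ), M.price s.toNNReal ω)) P :=
    hsell.1.const_mul _
  have hI3 : Integrable ({ω | D.Z X X r ω ≠ 0}.indicator fun _ => c) P :=
    (integrable_const c).indicator hE
  refine ⟨liquidation_isAdmissible D M hX hr, ?_, ?_, ?_, ?_⟩
  · filter_upwards [hslice] with ω hω using liquidation_intervalIntegrable_exchange D M hω
  · exact Eventually.of_forall fun ω => liquidation_intervalIntegrable_dark D
  · exact ((hI1.sub hI2).add hI3).congr hcost.symm
  · have e1 : ∫ ω, D.Z X X r ω * M.price (D.fillTime X X r ω) ω ∂P =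
        (∫ ω, D.Z X X r ω ∂P) * ∫ ω, M.price 0 ω ∂P := hfill.2
    have e2 : ∫ ω, D.Z X X r ω *
        (∫ s in (r : ℝ)..((r + r : ℝ≥0) : ℝ), M.price s.toNNReal ω) ∂P =
        (∫ ω, D.Z X X r ω ∂P) * ((((r + r : ℝ≥0) : ℝ) - r) * ∫ ω, M.price 0 ω ∂P) := hsell.2
    have hr' : (r : ℝ) ≠ 0 := by exact_mod_cast hr.ne'
    have hP : 0 < P.real {ω | D.Z X X r ω ≠ 0} :=
      ENNReal.toReal_pos (h.measure_Z_ne_zero_pos hX hr).ne' (measure_ne_top _ _)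
    have htot : ∫ ω, (liquidation D X r).cost M D 0 (r + r) ω ∂P =
        P.real {ω | D.Z X X r ω ≠ 0} * c := by
      -- Both price terms equal `E[Z_r] * E[P⁰_0]`, the second because the selling period has length
      -- `r`; they cancel.
      rw [integral_congr_ae hcost, integral_add ?_ hI3, integral_sub hI1 hI2,
        integral_const_mul, e1, e2, integral_indicator_const c hE, smul_eq_mul, NNReal.coe_add]
      · field_simp
        ring
      · exact hI1.sub hI2
    rw [htot]
    exact mul_neg_of_pos_of_neg hP hneg

end Fill

/-! ### Choice of the order size, and conclusion. -/

/-- Sublinear temporary impact is eventually dominated by the gain from permanent impact. -/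
theorem exists_pos_gain_of_sublinear {γ r : ℝ} {h : ℝ → ℝ} (hγ : 0 < γ) (hr : 0 < r)
    (hsub : Tendsto (fun x : ℝ => h x / x) (comap (fun x : ℝ => |x|) atTop) (𝓝 0)) :
    ∃ X : ℝ, 0 < X ∧ -(γ / 2 * X ^ 2) - X * h (-X / r) < 0 := by
  have hy : Tendsto (fun X : ℝ => -X / r) atTop (comap (fun x : ℝ => |x|) atTop) := by
    rw [tendsto_comap_iff]
    refine tendsto_abs_atBot_atTop.comp ?_
    exact tendsto_neg_atTop_atBot.atBot_div_const hr
  -- The threshold `γ * r / 2` is the break-even slope: at `x = -X / r`, a smaller quotient means `h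
  -- x > -γX / 2`, hence `-X * h x < γX² / 2`.
  have h1 := (hsub.comp hy).eventually (gt_mem_nhds (show (0 : ℝ) < γ * r / 2 by positivity))
  obtain ⟨X, hX1, hX⟩ := (h1.and (eventually_gt_atTop 0)).exists
  refine ⟨X, hX, ?_⟩
  have hX1' : h (-X / r) / (-X / r) < γ * r / 2 := hX1
  rw [div_lt_iff_of_neg (div_neg_of_neg_of_pos (neg_lt_zero.2 hX) hr)] at hX1'
  have h2 : γ * r / 2 * (-X / r) = -(γ * X / 2) := by field_simp
  rw [h2] at hX1'
  nlinarith

end DarkPool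
end

theorem mainTheorem7 {Ω : Type*} [MeasurableSpace Ω] (P : Measure Ω) [IsProbabilityMeasure P]
    (M : DarkPool.AlmgrenChrissModel P) (D : DarkPool.Extension P)
    (hInd : DarkPool.IndependenceAssumption M D)
    (hα : D.α = 1)
    (hsub : Tendsto (fun x : ℝ => M.h x / x) (comap (fun x : ℝ => |x|) atTop) (𝓝 0)) :
    ∀ T : ℝ≥0, 0 < T → DarkPool.HasPriceManipulation M D T := by
  intro T hT
  have hr : 0 < T / 2 := half_pos hT
  obtain ⟨X, hX, hneg⟩ := DarkPool.exists_pos_gain_of_sublinear M.γ_pos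
    (NNReal.coe_pos.2 hr) hsub
  rw [← add_halves T]
  exact ⟨DarkPool.liquidation D X (T / 2),
    DarkPool.liquidation_isPriceManipulation hInd hα hX hr hneg⟩
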